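/- Let $\mathcal A>0$ be rational, and let $\mathcal T_{\mathcal A}$ be the set of right triangles with rational side lengths and area $\mathcal A$, up to congruence. Such a triangle with legs $X,Y$ and hypotenuse $Z$ has two parameters $\frac{Y}{X+Z}$ and $\frac{X}{Y+Z}$ in $(0,1)\cap\mathbb Q$; exactly one of them has numerator and denominator (in lowest terms) of different parities, and it is called the parameter $t$ of the triangle. It satisfies $t(1-t^2)=\mathcal A r^2$ for some $r\in\mathbb Q$, and the triangle is identified with the pair $(t,r)$ with $r>0$, its negative with $(t,-r)$. The pairs $(t,r)\in\mathbb Q^2$ with $0\le t\le 1$ and $t(1-t^2)=\mathcal A r^2$ form an abelian group with zero element $(0,0)$, negation $-(t,r)=(t,-r)$ and sum $(t_1,r_1)+(t_2,r_2)=(t_3,r_3)$, where $$t_3=\frac{t_2(1-t_1^2)+t_1(1-t_2^2)+2\mathcal A r_1r_2}{(1+t_1t_2)^2},$$ $$r_3=\frac{r_1\big((1-t_2^2)(1-t_1t_2)-2t_2(t_1+t_2)\big)+r_2\big((1-t_1^2)(1-t_1t_2)-2t_1(t_1+t_2)\big)}{(1+t_1t_2)^3}.$$ Thus the sum and the difference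 of two triangles with parameters $t_1,t_2$ have the parameters $$\left(\frac{\sqrt{t_2(1-t_1^2)}+\sqrt{t_1(1-t_2^2)}}{1+t_1t_2}\right)^2\quad\text{and}\quad\left(\frac{\sqrt{t_2(1-t_1^2)}-\sqrt{t_1(1-t_2^2)}}{1+t_1t_2}\right)^2,$$ respectively. **Theorem.** There exist finitely many triangles $\triangle_1,\dots,\triangle_r$ in $\mathcal T_{\mathcal A}$ such that for every triangle $\triangle\in\mathcal T_{\mathcal A}$ there are integers $a_1,\dots,a_r$ for which $$\triangle=a_1\triangle_1+\cdots+a_r\triangle_r$$ in this group. -/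

import Mathlib

/-- A right triangle with rational side lengths and area `A`, up to congruence: the two legs are
listed in increasing order, so each congruence class occurs exactly once
(equal legs are impossible for rational sides). -/
structure RatRightTriangle (A : ℚ) where
  shortLeg : ℚ
  longLeg : ℚ
  hyp : ℚ
  shortLeg_pos : 0 < shortLeg
  shortLeg_lt_longLeg : shortLeg < longLeg
  hyp_pos : 0 < hyp
  pythagoras : shortLeg ^ 2 + longLeg ^ 2 = hyp ^ 2
  area_eq : shortLeg * longLeg / 2 = A

/-- Numerator and denominator (in lowest terms) have different parities. -/
def OppositeParity (t : ℚ) : Prop := ¬ (Even t.num ↔ Even t.den)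

instance (t : ℚ) : Decidable (OppositeParity t) := by
  unfold OppositeParity; infer_instance

/-- Signed parameters for area `A`: pairs `(t, r)` of rationals with `0 ≤ t ≤ 1` and
`t (1 - t ^ 2) = A r ^ 2`. A parameter `0 < t < 1` occurs with the two opposite values of `r`
(the triangle and its negative), and `t = 0` is the zero element. -/
@[ext]
structure SignedParam (A : ℚ) (hA : 0 < A) where
  t : ℚ
  r : ℚ
  t_nonneg : 0 ≤ t
  t_le_one : t ≤ 1
  curve : t * (1 - t ^ 2) = A * r ^ 2

namespace SignedParam

variable {A : ℚ} {hA : 0 < A}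

/-- The parameter of the sum. Since `(A r₁ r₂) ^ 2 = t₁ t₂ (1 - t₁ ^ 2) (1 - t₂ ^ 2)`, it equals
`((√(t₂ (1 - t₁ ^ 2)) ± √(t₁ (1 - t₂ ^ 2))) / (1 + t₁ t₂)) ^ 2`, with `+` if `r₁ r₂ ≥ 0` (addition)
and `-` if `r₁ r₂ ≤ 0` (subtraction). -/
def addT (A t₁ r₁ t₂ r₂ : ℚ) : ℚ :=
  (t₂ * (1 - t₁ ^ 2) + t₁ * (1 - t₂ ^ 2) + 2 * (A * r₁ * r₂)) / (1 + t₁ * t₂) ^ 2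

/-- The signed square root of `t (1 - t ^ 2) / A` attached to the parameter `t` of the sum. -/
def addR (t₁ r₁ t₂ r₂ : ℚ) : ℚ :=
  (r₁ * ((1 - t₂ ^ 2) * (1 - t₁ * t₂) - 2 * t₂ * (t₁ + t₂)) +
    r₂ * ((1 - t₁ ^ 2) * (1 - t₁ * t₂) - 2 * t₁ * (t₁ + t₂))) / (1 + t₁ * t₂) ^ 3

theorem denom_pos (P Q : SignedParam A hA) : 0 < 1 + P.t * Q.t := by
  have := mul_nonneg P.t_nonneg Q.t_nonneg
  linarith

theorem prod_sq (P Q : SignedParam A hA) :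
    (A * P.r * Q.r) ^ 2 = P.t * (1 - P.t ^ 2) * (Q.t * (1 - Q.t ^ 2)) := by
  rw [P.curve, Q.curve]; ring

theorem addT_nonneg (P Q : SignedParam A hA) : 0 ≤ addT A P.t P.r Q.t Q.r := by
  have hw := prod_sq P Q
  have h1 := P.t_nonneg
  have h2 := Q.t_nonneg
  have h3 : 0 ≤ 1 - P.t ^ 2 := by nlinarith [P.t_le_one]
  have h4 : 0 ≤ 1 - Q.t ^ 2 := by nlinarith [Q.t_le_one]
  unfold addT
  apply div_nonneg _ (by positivity)
  set w := A * P.r * Q.r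
  have ha : 0 ≤ Q.t * (1 - P.t ^ 2) := by positivity
  have hb : 0 ≤ P.t * (1 - Q.t ^ 2) := by positivity
  have : |2 * w| ≤ Q.t * (1 - P.t ^ 2) + P.t * (1 - Q.t ^ 2) := by
    apply abs_le_of_sq_le_sq _ (by positivity)
    nlinarith [sq_nonneg (Q.t * (1 - P.t ^ 2) - P.t * (1 - Q.t ^ 2))]
  linarith [neg_abs_le (2 * w)]

theorem addT_le_one (P Q : SignedParam A hA) : addT A P.t P.r Q.t Q.r ≤ 1 := by
  have hw := prod_sq P Q
  have h1 := P.t_nonneg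
  have h2 := Q.t_nonneg
  have h3 : 0 ≤ 1 - P.t := by linarith [P.t_le_one]
  have h4 : 0 ≤ 1 - Q.t := by linarith [Q.t_le_one]
  unfold addT
  rw [div_le_one (by have := denom_pos P Q; positivity)]
  set w := A * P.r * Q.r
  have he : 0 ≤ (1 - P.t) * (1 - Q.t) := by positivity
  have hf : 0 ≤ P.t * Q.t * ((1 + P.t) * (1 + Q.t)) := by positivity
  have : |2 * w| ≤ (1 - P.t) * (1 - Q.t) + P.t * Q.t * ((1 + P.t) * (1 + Q.t)) := by
    apply abs_le_of_sq_le_sq _ (by positivity)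
    nlinarith [sq_nonneg ((1 - P.t) * (1 - Q.t) - P.t * Q.t * ((1 + P.t) * (1 + Q.t)))]
  linarith [le_abs_self (2 * w)]

theorem add_curve (P Q : SignedParam A hA) :
    addT A P.t P.r Q.t Q.r * (1 - addT A P.t P.r Q.t Q.r ^ 2) =
      A * addR P.t P.r Q.t Q.r ^ 2 := by
  have hd := (denom_pos P Q).ne'
  have hw := prod_sq P Q
  have hP := P.curve
  have hQ := Q.curve
  unfold addT addR
  generalize P.t = a at *
  generalize Q.t = b at *
  generalize P.r = r at *
  generalize Q.r = s at *
  have key : ∀ N R D : ℚ, D ≠ 0 → N * (D ^ 4 - N ^ 2) = A * R ^ 2 →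
      N / D ^ 2 * (1 - (N / D ^ 2) ^ 2) = A * (R / D ^ 3) ^ 2 := by
    intro N R D hD h
    field_simp
    linear_combination h
  apply key _ _ _ hd
  linear_combination
    ((1 - b ^ 2) * (1 - a * b) - 2 * b * (a + b)) ^ 2 * hP
    + ((1 - a ^ 2) * (1 - a * b) - 2 * a * (a + b)) ^ 2 * hQ
    - (12 * (b * (1 - a ^ 2) + a * (1 - b ^ 2)) + 8 * (A * r * s)) * hw

instance : Zero (SignedParam A hA) := ⟨⟨0, 0, le_rfl, zero_le_one, by ring⟩⟩

/-- The negative of a signed parameter: same `t`, opposite sign of `r`. -/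
instance : Neg (SignedParam A hA) :=
  ⟨fun P => ⟨P.t, -P.r, P.t_nonneg, P.t_le_one, by rw [neg_sq, P.curve]⟩⟩

/-- Addition of signed parameters. For triangles with parameters `t₁`, `t₂`, both taken with
`r > 0`, the sum and the difference have the parameters
`((√(t₂ (1 - t₁ ^ 2)) ± √(t₁ (1 - t₂ ^ 2))) / (1 + t₁ t₂)) ^ 2`; the sign of `r` is the one that
makes the operation a group law. -/
instance : Add (SignedParam A hA) :=
  ⟨fun P Q => ⟨addT A P.t P.r Q.t Q.r, addR P.t P.r Q.t Q.r,
    addT_nonneg P Q, addT_le_one P Q, add_curve P Q⟩⟩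

@[simp] theorem zero_t : (0 : SignedParam A hA).t = 0 := rfl
@[simp] theorem zero_r : (0 : SignedParam A hA).r = 0 := rfl
@[simp] theorem neg_t (P : SignedParam A hA) : (-P).t = P.t := rfl
@[simp] theorem neg_r (P : SignedParam A hA) : (-P).r = -P.r := rfl
theorem add_t (P Q : SignedParam A hA) : (P + Q).t = addT A P.t P.r Q.t Q.r := rfl
theorem add_r (P Q : SignedParam A hA) : (P + Q).r = addR P.t P.r Q.t Q.r := rfl

theorem eq_zero_of_t (P : SignedParam A hA) (h : P.t = 0) : P = 0 := by
  have hc := P.curve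
  rw [h] at hc
  have : P.r = 0 := by
    have : A * P.r ^ 2 = 0 := by rw [← hc]; ring
    simpa [hA.ne'] using this
  ext <;> simp [h, this]

/-- The congruent number curve `y ^ 2 = x ^ 3 - A ^ 2 x`, used to verify the group axioms. -/
def congruentCurve (A : ℚ) : WeierstrassCurve.Affine ℚ :=
  { a₁ := 0, a₂ := 0, a₃ := 0, a₄ := -A ^ 2, a₆ := 0 }

theorem nonsingular_toPoint (P : SignedParam A hA) (h : P.t ≠ 0) :
    (congruentCurve A).Nonsingular (A / P.t) (P.r * A ^ 2 / P.t ^ 2) := by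
  have hc := P.curve
  have hA' := hA.ne'
  rw [WeierstrassCurve.Affine.nonsingular_iff', WeierstrassCurve.Affine.equation_iff']
  simp only [congruentCurve]
  constructor
  · field_simp
    linear_combination (-A ^ 3) * hc
  · by_cases hr : P.r = 0
    · left
      rw [hr] at hc ⊢
      have : P.t ^ 2 = 1 := by
        have : P.t * (1 - P.t ^ 2) = 0 := by rw [hc]; ring
        rcases mul_eq_zero.mp this with h' | h'
        · exact absurd h' h
        · linarith
      rw [div_pow, this]
      have : A ^ 2 ≠ 0 := by positivity
      intro h0
      apply this
      linarith
    · right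
      have : P.r * A ^ 2 / P.t ^ 2 ≠ 0 := by positivity
      intro h0
      apply this
      linarith

/-- The point `(A / t, r A ^ 2 / t ^ 2)` of the congruent number curve. -/
def toPoint (P : SignedParam A hA) : (congruentCurve A).Point :=
  if h : P.t = 0 then 0 else .some _ _ (nonsingular_toPoint P h)

theorem chord_identity {A a b r s : ℚ} (hA : A ≠ 0) (ha : a ≠ 0) (hb : b ≠ 0) (hab : a ≠ b)
    (hd : 1 + a * b ≠ 0) (hP : a * (1 - a ^ 2) = A * r ^ 2) (hQ : b * (1 - b ^ 2) = A * s ^ 2) :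
    addT A a r b s ≠ 0 ∧
    A / addT A a r b s = ((r * A ^ 2 / a ^ 2 - s * A ^ 2 / b ^ 2) / (A / a - A / b)) ^ 2
      - A / a - A / b ∧
    addR a r b s * A ^ 2 / addT A a r b s ^ 2 =
      (r * A ^ 2 / a ^ 2 - s * A ^ 2 / b ^ 2) / (A / a - A / b) *
        (A / a - A / addT A a r b s) - r * A ^ 2 / a ^ 2 := by
  have hba : b - a ≠ 0 := sub_ne_zero.mpr (Ne.symm hab)
  have hab' : a - b ≠ 0 := sub_ne_zero.mpr hab
  have hsl : (r * A ^ 2 / a ^ 2 - s * A ^ 2 / b ^ 2) / (A / a - A / b) =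
      A * (r * b ^ 2 - s * a ^ 2) / (a * b * (b - a)) := by
    have : A / a - A / b = A * (b - a) / (a * b) := by field_simp
    rw [this]
    field_simp
  rw [hsl]
  unfold addT addR
  obtain ⟨w, hwd⟩ : ∃ w, w = A * r * s := ⟨_, rfl⟩
  rw [← hwd]
  have hwr : w * r = a * (1 - a ^ 2) * s := by rw [hwd, hP]; ring
  have hws : w * s = b * (1 - b ^ 2) * r := by rw [hwd, hQ]; ring
  have hw : w ^ 2 = a * (1 - a ^ 2) * (b * (1 - b ^ 2)) := by rw [hP, hQ, hwd]; ring
  obtain ⟨N, hN⟩ : ∃ N, N = b * (1 - a ^ 2) + a * (1 - b ^ 2) + 2 * w := ⟨_, rfl⟩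
  obtain ⟨M, hM⟩ : ∃ M, M = b * (1 - a ^ 2) + a * (1 - b ^ 2) - 2 * w := ⟨_, rfl⟩
  obtain ⟨D, hD⟩ : ∃ D, D = 1 + a * b := ⟨_, rfl⟩
  have hNM : N * M = (b - a) ^ 2 * D ^ 2 := by
    rw [hN, hM, hD]; linear_combination (-4) * hw
  rw [← hN, ← hD]
  rw [← hD] at hd
  have hN0 : N ≠ 0 := by
    rintro rfl
    have : (b - a) ^ 2 * D ^ 2 ≠ 0 := by positivity
    exact this (by rw [← hNM, zero_mul])
  have hX : A / (N / D ^ 2) = A * M / (b - a) ^ 2 := by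
    field_simp
    linear_combination -hNM
  have hT : N / D ^ 2 = (b - a) ^ 2 / M := by
    have hM0 : M ≠ 0 := by
      rintro rfl
      have : (b - a) ^ 2 * D ^ 2 ≠ 0 := by positivity
      exact this (by rw [← hNM, mul_zero])
    field_simp
    linear_combination hNM
  refine ⟨div_ne_zero hN0 (by positivity), ?_, ?_⟩
  · rw [hX]
    have h1 : (A * (r * b ^ 2 - s * a ^ 2) / (a * b * (b - a))) ^ 2 - A / a - A / b =
        A * (A * (r * b ^ 2 - s * a ^ 2) ^ 2 - (a + b) * (a * b) * (b - a) ^ 2) /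
          (a ^ 2 * b ^ 2 * (b - a) ^ 2) := by
      field_simp
      ring
    rw [h1, div_eq_div_iff (by positivity) (by positivity)]
    have h2 : A * (r * b ^ 2 - s * a ^ 2) ^ 2 - (a + b) * (a * b) * (b - a) ^ 2 =
        M * a ^ 2 * b ^ 2 := by
      rw [hM, hwd]
      linear_combination (-b ^ 4) * hP - a ^ 4 * hQ
    linear_combination (-A * (b - a) ^ 2) * h2
  · rw [hX]
    obtain ⟨R, hR⟩ : ∃ R, R = r * ((1 - b ^ 2) * (1 - a * b) - 2 * b * (a + b)) +
      s * ((1 - a ^ 2) * (1 - a * b) - 2 * a * (a + b)) := ⟨_, rfl⟩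
    rw [← hR]
    have h1 : R / D ^ 3 * A ^ 2 / (N / D ^ 2) ^ 2 =
        A ^ 2 * R * M ^ 2 / (D ^ 3 * (b - a) ^ 4) := by
      have : R / D ^ 3 * A ^ 2 / (N / D ^ 2) ^ 2 = R / D ^ 3 * (A / (N / D ^ 2)) ^ 2 := by
        field_simp
      rw [this, hX]
      field_simp
    have h2 : A * (r * b ^ 2 - s * a ^ 2) / (a * b * (b - a)) *
        (A / a - A * M / (b - a) ^ 2) - r * A ^ 2 / a ^ 2 =
        A ^ 2 * ((r * b ^ 2 - s * a ^ 2) * ((b - a) ^ 2 - a * M) - r * b * (b - a) ^ 3) /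
          (a ^ 2 * b * (b - a) ^ 3) := by
      field_simp
    rw [h1, h2, div_eq_div_iff (by positivity) (by positivity)]
    have h3 : D ^ 3 * (b - a) *
          ((r * b ^ 2 - s * a ^ 2) * ((b - a) ^ 2 - a * M) - r * b * (b - a) ^ 3) =
        a ^ 2 * b * R * M ^ 2 := by
      rw [hR, hM, hD]
      linear_combination 2 * a * b ^ 2 * (1 + a * b) ^ 3 * (b - a) * hwr
        - 2 * a ^ 3 * (1 + a * b) ^ 3 * (b - a) * hws
        - 4 * a ^ 2 * b * (r * ((1 - b ^ 2) * (1 - a * b) - 2 * b * (a + b)) +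
          s * ((1 - a ^ 2) * (1 - a * b) - 2 * a * (a + b))) * hw
        + 4 * a ^ 2 * b * (b * (1 - a ^ 2) + a * (1 - b ^ 2)) *
          (((1 - b ^ 2) * (1 - a * b) - 2 * b * (a + b)) * hwr
            + ((1 - a ^ 2) * (1 - a * b) - 2 * a * (a + b)) * hws)
    linear_combination (-A ^ 2 * (b - a) ^ 3) * h3

theorem tangent_identity {A a r : ℚ} (hA : A ≠ 0) (ha : a ≠ 0) (hr : r ≠ 0)
    (hP : a * (1 - a ^ 2) = A * r ^ 2) :
    addT A a r a r ≠ 0 ∧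
    A / addT A a r a r = ((3 * (A / a) ^ 2 - A ^ 2) / (2 * (r * A ^ 2 / a ^ 2))) ^ 2
      - A / a - A / a ∧
    addR a r a r * A ^ 2 / addT A a r a r ^ 2 =
      (3 * (A / a) ^ 2 - A ^ 2) / (2 * (r * A ^ 2 / a ^ 2)) *
        (A / a - A / addT A a r a r) - r * A ^ 2 / a ^ 2 := by
  have hd : 1 + a ^ 2 ≠ 0 := by positivity
  have hsl : (3 * (A / a) ^ 2 - A ^ 2) / (2 * (r * A ^ 2 / a ^ 2)) = (3 - a ^ 2) / (2 * r) := by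
    field_simp
  have hA2 : A = a * (1 - a ^ 2) / r ^ 2 := by field_simp; linarith
  have hT : addT A a r a r = 4 * A * r ^ 2 / (1 + a ^ 2) ^ 2 := by
    unfold addT
    rw [show 1 + a * a = 1 + a ^ 2 by ring]
    congr 1
    linear_combination 2 * hP
  have hX : A / addT A a r a r = (1 + a ^ 2) ^ 2 / (4 * r ^ 2) := by
    rw [hT]; field_simp
  refine ⟨by rw [hT]; positivity, ?_, ?_⟩
  · rw [hsl, hX]
    have : A / a = (1 - a ^ 2) / r ^ 2 := by rw [hA2]; field_simp
    rw [this]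
    field_simp
    ring
  · rw [hsl, hX]
    have h1 : A / a = (1 - a ^ 2) / r ^ 2 := by rw [hA2]; field_simp
    have h2 : r * A ^ 2 / a ^ 2 = r * (A / a) ^ 2 := by field_simp
    have h3 : addR a r a r * A ^ 2 / addT A a r a r ^ 2 =
       addR a r a r * (A / addT A a r a r) ^ 2 := by rw [div_pow, mul_div_assoc]
    rw [h3, h2, hX, h1]
    unfold addR
    rw [show 1 + a * a = 1 + a ^ 2 by ring]
    field_simp
    ring

theorem toPoint_injective : Function.Injective (toPoint : SignedParam A hA → _) := by
  intro P Q h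
  unfold toPoint at h
  have hA' := hA.ne'
  split_ifs at h with h1 h2 h2
  · rw [eq_zero_of_t P h1, eq_zero_of_t Q h2]
  · injection h with hx hy
    have ht : P.t = Q.t := by
      field_simp at hx
      exact hx.symm
    rw [ht] at hy
    have hr : P.r = Q.r := by
      field_simp at hy
      exact hy
    exact SignedParam.ext ht hr

theorem toPoint_zero : (0 : SignedParam A hA).toPoint = 0 := by
  simp [toPoint]

theorem toPoint_neg (P : SignedParam A hA) : (-P).toPoint = -P.toPoint := by
  unfold toPoint
  by_cases h : P.t = 0
  · simp [h]
  · rw [dif_neg h, dif_neg (by simpa using h), WeierstrassCurve.Affine.Point.neg_some]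
    congr 1
    simp [WeierstrassCurve.Affine.negY, congruentCurve]
    ring

theorem toPoint_add (P Q : SignedParam A hA) : (P + Q).toPoint = P.toPoint + Q.toPoint := by
  have hA' := hA.ne'
  by_cases hP : P.t = 0
  · rw [eq_zero_of_t P hP, toPoint_zero, zero_add]
    congr 1
    ext <;> simp [add_t, add_r, addT, addR]
  by_cases hQ : Q.t = 0
  · rw [eq_zero_of_t Q hQ, toPoint_zero, add_zero]
    congr 1
    ext <;> simp [add_t, add_r, addT, addR]
  have hcP := P.curve
  have hcQ := Q.curve
  by_cases h0 : P.t = Q.t ∧ P.r = -Q.r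
  · have hPQ : P = -Q := SignedParam.ext h0.1 h0.2
    have hz : P + Q = 0 := by
      apply eq_zero_of_t
      rw [add_t, hPQ, addT]
      simp only [neg_t, neg_r]
      rw [div_eq_zero_iff]
      left
      linear_combination 2 * hcQ
    rw [hz, hPQ, toPoint_neg, toPoint_zero, neg_add_cancel]
  have hd := (denom_pos P Q).ne'
  have hxy : ¬ (A / P.t = A / Q.t ∧ P.r * A ^ 2 / P.t ^ 2 =
      (congruentCurve A).negY (A / Q.t) (Q.r * A ^ 2 / Q.t ^ 2)) := by
    rintro ⟨hx, hy⟩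
    have ht : P.t = Q.t := by
      field_simp at hx
      exact hx.symm
    apply h0
    refine ⟨ht, ?_⟩
    simp only [WeierstrassCurve.Affine.negY, congruentCurve, ht, zero_mul, sub_zero] at hy
    field_simp at hy
    linarith
  have key : addT A P.t P.r Q.t Q.r ≠ 0 ∧
      A / addT A P.t P.r Q.t Q.r = (congruentCurve A).addX (A / P.t) (A / Q.t)
        ((congruentCurve A).slope (A / P.t) (A / Q.t)
          (P.r * A ^ 2 / P.t ^ 2) (Q.r * A ^ 2 / Q.t ^ 2)) ∧
      addR P.t P.r Q.t Q.r * A ^ 2 / addT A P.t P.r Q.t Q.r ^ 2 =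
        (congruentCurve A).addY (A / P.t) (A / Q.t) (P.r * A ^ 2 / P.t ^ 2)
        ((congruentCurve A).slope (A / P.t) (A / Q.t)
          (P.r * A ^ 2 / P.t ^ 2) (Q.r * A ^ 2 / Q.t ^ 2)) := by
    by_cases ht : P.t = Q.t
    · have hr : P.r = Q.r := by
        have h1 : P.r ^ 2 = Q.r ^ 2 := by
          rw [ht, hcQ] at hcP
          exact (mul_left_cancel₀ hA' hcP).symm
        rcases sq_eq_sq_iff_eq_or_eq_neg.mp h1 with h | h
        · exact h
        · exact absurd ⟨ht, h⟩ h0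
      have hPQ : P = Q := SignedParam.ext ht hr
      subst hPQ
      have hr0 : P.r ≠ 0 := by
        intro h
        exact h0 ⟨rfl, by rw [h, neg_zero]⟩
      obtain ⟨k1, k2, k3⟩ := tangent_identity hA' hP hr0 hcP
      have hy : P.r * A ^ 2 / P.t ^ 2 ≠
          (congruentCurve A).negY (A / P.t) (P.r * A ^ 2 / P.t ^ 2) := fun h => hxy ⟨rfl, h⟩
      have hs : (congruentCurve A).slope (A / P.t) (A / P.t)
          (P.r * A ^ 2 / P.t ^ 2) (P.r * A ^ 2 / P.t ^ 2) =
          (3 * (A / P.t) ^ 2 - A ^ 2) / (2 * (P.r * A ^ 2 / P.t ^ 2)) := by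
        rw [WeierstrassCurve.Affine.slope_of_Y_ne rfl hy]
        simp only [WeierstrassCurve.Affine.negY, congruentCurve]
        congr 1 <;> ring
      rw [hs]
      have hx : A / addT A P.t P.r P.t P.r = (congruentCurve A).addX (A / P.t) (A / P.t)
          ((3 * (A / P.t) ^ 2 - A ^ 2) / (2 * (P.r * A ^ 2 / P.t ^ 2))) := by
        rw [k2]; simp only [WeierstrassCurve.Affine.addX, congruentCurve]; ring
      refine ⟨k1, hx, ?_⟩
      rw [WeierstrassCurve.Affine.addY, WeierstrassCurve.Affine.negAddY, ← hx, k3]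
      simp only [WeierstrassCurve.Affine.negY, congruentCurve]; ring
    · obtain ⟨k1, k2, k3⟩ := chord_identity hA' hP hQ ht hd hcP hcQ
      have hxne : A / P.t ≠ A / Q.t := by
        intro h
        field_simp at h
        exact ht h.symm
      rw [WeierstrassCurve.Affine.slope_of_X_ne hxne]
      have hx : A / addT A P.t P.r Q.t Q.r = (congruentCurve A).addX (A / P.t) (A / Q.t)
          ((P.r * A ^ 2 / P.t ^ 2 - Q.r * A ^ 2 / Q.t ^ 2) / (A / P.t - A / Q.t)) := by
        rw [k2]; simp only [WeierstrassCurve.Affine.addX, congruentCurve]; ring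
      refine ⟨k1, hx, ?_⟩
      rw [WeierstrassCurve.Affine.addY, WeierstrassCurve.Affine.negAddY, ← hx, k3]
      simp only [WeierstrassCurve.Affine.negY, congruentCurve]; ring
  obtain ⟨k1, k2, k3⟩ := key
  rw [toPoint, toPoint, toPoint, dif_neg hP, dif_neg hQ, dif_neg (by rw [add_t]; exact k1),
    WeierstrassCurve.Affine.Point.add_some hxy]
  simp only [add_t, add_r, WeierstrassCurve.Affine.Point.some.injEq]
  exact ⟨k2, k3⟩

/-- Signed parameters form an abelian group under the parameter addition. -/
instance : AddCommGroup (SignedParam A hA) where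
  add_assoc P Q R := toPoint_injective (by simp only [toPoint_add, add_assoc])
  zero_add P := toPoint_injective (by simp only [toPoint_add, toPoint_zero, zero_add])
  add_zero P := toPoint_injective (by simp only [toPoint_add, toPoint_zero, add_zero])
  add_comm P Q := toPoint_injective (by simp only [toPoint_add, add_comm])
  neg_add_cancel P :=
    toPoint_injective (by simp only [toPoint_add, toPoint_neg, toPoint_zero, neg_add_cancel])
  nsmul := nsmulRec
  zsmul := zsmulRec

/-- For positive orientations, the parameter of the sum is given by the usual formula. -/
theorem add_t_eq (P Q : SignedParam A hA) (hP : 0 ≤ P.r) (hQ : 0 ≤ Q.r) :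
    ((P + Q).t : ℝ) = ((√((Q.t * (1 - P.t ^ 2) : ℚ) : ℝ) + √((P.t * (1 - Q.t ^ 2) : ℚ) : ℝ)) /
      (1 + P.t * Q.t)) ^ 2 := by
  have hw := prod_sq P Q
  have h3 : 0 ≤ 1 - P.t ^ 2 := by nlinarith [P.t_le_one, P.t_nonneg]
  have h4 : 0 ≤ 1 - Q.t ^ 2 := by nlinarith [Q.t_le_one, Q.t_nonneg]
  have ha : 0 ≤ Q.t * (1 - P.t ^ 2) := mul_nonneg Q.t_nonneg h3
  have hb : 0 ≤ P.t * (1 - Q.t ^ 2) := mul_nonneg P.t_nonneg h4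
  have hs : √((Q.t * (1 - P.t ^ 2) : ℚ) : ℝ) * √((P.t * (1 - Q.t ^ 2) : ℚ) : ℝ) =
      ((A * P.r * Q.r : ℚ) : ℝ) := by
    rw [← Real.sqrt_mul (by exact_mod_cast ha), ← Rat.cast_mul,
      show Q.t * (1 - P.t ^ 2) * (P.t * (1 - Q.t ^ 2)) = (A * P.r * Q.r) ^ 2 by rw [hw]; ring,
      Rat.cast_pow, Real.sqrt_sq]
    have : 0 ≤ A * P.r * Q.r := by positivity
    exact_mod_cast this
  rw [div_pow, add_sq, Real.sq_sqrt (by exact_mod_cast ha), Real.sq_sqrt (by exact_mod_cast hb),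
    mul_assoc, hs, add_t, addT]
  push_cast
  ring

/-- For positive orientations, the parameter of the difference is given by the usual formula. -/
theorem sub_t_eq (P Q : SignedParam A hA) (hP : 0 ≤ P.r) (hQ : 0 ≤ Q.r) :
    ((P - Q).t : ℝ) = ((√((Q.t * (1 - P.t ^ 2) : ℚ) : ℝ) - √((P.t * (1 - Q.t ^ 2) : ℚ) : ℝ)) /
      (1 + P.t * Q.t)) ^ 2 := by
  have hw := prod_sq P Q
  have h3 : 0 ≤ 1 - P.t ^ 2 := by nlinarith [P.t_le_one, P.t_nonneg]
  have h4 : 0 ≤ 1 - Q.t ^ 2 := by nlinarith [Q.t_le_one, Q.t_nonneg]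
  have ha : 0 ≤ Q.t * (1 - P.t ^ 2) := mul_nonneg Q.t_nonneg h3
  have hb : 0 ≤ P.t * (1 - Q.t ^ 2) := mul_nonneg P.t_nonneg h4
  have hs : √((Q.t * (1 - P.t ^ 2) : ℚ) : ℝ) * √((P.t * (1 - Q.t ^ 2) : ℚ) : ℝ) =
      ((A * P.r * Q.r : ℚ) : ℝ) := by
    rw [← Real.sqrt_mul (by exact_mod_cast ha), ← Rat.cast_mul,
      show Q.t * (1 - P.t ^ 2) * (P.t * (1 - Q.t ^ 2)) = (A * P.r * Q.r) ^ 2 by rw [hw]; ring,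
      Rat.cast_pow, Real.sqrt_sq]
    have : 0 ≤ A * P.r * Q.r := by positivity
    exact_mod_cast this
  rw [div_pow, sub_sq, Real.sq_sqrt (by exact_mod_cast ha), Real.sq_sqrt (by exact_mod_cast hb),
    mul_assoc, hs, sub_eq_add_neg P Q, add_t, addT, neg_t, neg_r]
  push_cast
  ring

end SignedParam


namespace RatRightTriangle

variable {A : ℚ}

theorem longLeg_pos (T : RatRightTriangle A) : 0 < T.longLeg :=
  T.shortLeg_pos.trans T.shortLeg_lt_longLeg

/-- For a right triangle with legs `x`, `y`, hypotenuse `z` and area `A`, the parameter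
`t = tan (α / 2) = y / (x + z)`, where `α` is the angle opposite `y`, with the positive value
`r = 2 / (x + z)` of the square root of `t (1 - t ^ 2) / A`. -/
def legParam (hA : 0 < A) (x y z : ℚ) (hx : 0 < x) (hy : 0 < y) (hz : 0 < z)
    (h : x ^ 2 + y ^ 2 = z ^ 2) (harea : x * y / 2 = A) : SignedParam A hA where
  t := y / (x + z)
  r := 2 / (x + z)
  t_nonneg := by positivity
  t_le_one := by
    rw [div_le_one (by positivity)]
    nlinarith
  curve := by
    rw [← harea]
    field_simp
    linear_combination -h

/-- The signed parameter of a triangle: of its two parameters `y / (x + z)`, one for each ordering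
`x`, `y` of the legs, the one whose numerator and denominator have different parities,
with `r > 0`. -/
def toParam (hA : 0 < A) (T : RatRightTriangle A) : SignedParam A hA :=
  if OppositeParity (T.shortLeg / (T.longLeg + T.hyp)) then
    legParam hA T.longLeg T.shortLeg T.hyp T.longLeg_pos T.shortLeg_pos T.hyp_pos
      (by rw [add_comm, T.pythagoras]) (by rw [mul_comm, T.area_eq])
  else
    legParam hA T.shortLeg T.longLeg T.hyp T.shortLeg_pos T.longLeg_pos T.hyp_pos
      T.pythagoras T.area_eq

end RatRightTriangle

/-! The group of signed parameters is finitely generated, by infinite descent (it is isomorphic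
to the group of rational points on the identity component of the congruent number curve, so this is
a case of Mordell's theorem). A subgroup of a finitely generated abelian group is finitely generated, and
in particular the subgroup spanned by the triangles is spanned by finitely many of them.

The height of a point is the denominator of its parameter `t`; since `0 ≤ t ≤ 1`, only finitely many
points lie below a given height. The addition formula shows that the denominator of the sum divides
a square and gives `den (P + Q) ≤ 4 * den P ^ 2 * den Q ^ 2` (`den_add_le`), and for the double the
fraction `4 p q (q² - p²) / (p² + q²)²` hardly cancels, so `den R ^ 4 ≤ 16 * den (R + R)`
(`den_pow_four_le`).

The numbers `A t`, `1 - t`, `1 + t` are multiplicative modulo squares (`add_t_mul_mul` and the two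
lemmas after it), and a point for which all three are squares can be halved explicitly
(`exists_add_self_eq`). Their square classes take finitely many values, as their valuations are even
at all primes at which `2` and `A` are units (`even_padicValRat`). So every `P` has the form `R + R - Q` with `Q`
from a finite set of representatives, and by the two height estimates `R` is of smaller height than
`P` once the height of `P` exceeds a constant. -/

/-! ### Square classes of positive rationals -/

theorem Nat.isSquare_of_even_padicValNat {n : ℕ} (hn : n ≠ 0)
    (h : ∀ p : ℕ, p.Prime → Even (padicValNat p n)) : IsSquare n := by
  obtain ⟨a, b, rfl, ha⟩ := Nat.sq_mul_squarefree n
  have hb : b ≠ 0 := by rintro rfl; simp at hn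
  have ha0 : a ≠ 0 := ha.ne_zero
  have : a = 1 := by
    by_contra h1
    obtain ⟨p, hp, hpa⟩ := Nat.exists_prime_and_dvd h1
    have := Fact.mk hp
    have h2 := h p hp
    rw [padicValNat.mul (pow_ne_zero 2 hb) ha0, padicValNat.pow] at h2
    have h3 : padicValNat p a = 1 := by
      rw [← Nat.factorization_def a hp]
      exact Nat.factorization_eq_one_of_squarefree ha hp hpa
    rw [h3] at h2
    grind
  rw [this, mul_one]
  exact IsSquare.sq b

theorem Rat.isSquare_of_even_padicValRat {x : ℚ} (hx : 0 < x)
    (h : ∀ p : ℕ, p.Prime → Even (padicValRat p x)) : IsSquare x := by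
  have hd : (x.den : ℚ) ≠ 0 := by exact_mod_cast x.den_nz
  have hnum : 0 < x.num := Rat.num_pos.mpr hx
  have hxn : x * (x.den : ℚ) ^ 2 = ((x.num.natAbs * x.den : ℕ) : ℚ) := by
    have h1 : x * x.den = x.num := Rat.mul_den_eq_num x
    have h2 : ((x.num.natAbs : ℕ) : ℚ) = x.num := by
      rw [Nat.cast_natAbs, abs_of_pos hnum]
    push_cast
    rw [h2, ← h1]; ring
  have hsq : IsSquare (x.num.natAbs * x.den) := by
    refine Nat.isSquare_of_even_padicValNat (mul_ne_zero (by omega) x.den_nz) fun p hp => ?_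
    have := Fact.mk hp
    have h1 : (padicValNat p (x.num.natAbs * x.den) : ℤ) =
        padicValRat p x + 2 * padicValRat p (x.den : ℚ) := by
      rw [← padicValRat.of_nat, ← hxn, padicValRat.mul hx.ne' (pow_ne_zero 2 hd),
        padicValRat.pow]
      norm_num
    have h2 : Even (padicValNat p (x.num.natAbs * x.den) : ℤ) := by
      rw [h1]; exact (h p hp).add (even_two_mul _)
    exact_mod_cast h2
  obtain ⟨m, hm⟩ := hsq
  refine ⟨m / x.den, ?_⟩
  rw [hm] at hxn
  push_cast at hxn
  field_simp
  linarith

/-- Two positive rationals whose valuations have the same parity at every prime have the same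
square class. -/
theorem Rat.isSquare_mul_of_even_padicValRat_iff {x y : ℚ} (hx : 0 < x) (hy : 0 < y)
    (h : ∀ p : ℕ, p.Prime → (Even (padicValRat p x) ↔ Even (padicValRat p y))) :
    IsSquare (x * y) := by
  refine Rat.isSquare_of_even_padicValRat (mul_pos hx hy) fun p hp => ?_
  have := Fact.mk hp
  rw [padicValRat.mul hx.ne' hy.ne', Int.even_add]
  exact h p hp

namespace SignedParam

variable {A : ℚ} {hA : 0 < A}

/-! ### The homomorphism to square classes -/

theorem add_t_mul_mul (P Q : SignedParam A hA) : (P + Q).t * (P.t * Q.t) =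
    A * ((Q.t * P.r + P.t * Q.r) / (1 + P.t * Q.t)) ^ 2 := by
  have hP := P.curve
  have hQ := Q.curve
  rw [add_t, addT, div_pow, div_mul_eq_mul_div, ← mul_div_assoc]
  congr 1
  linear_combination Q.t ^ 2 * hP + P.t ^ 2 * hQ

theorem one_sub_add_t_mul_mul (P Q : SignedParam A hA) :
    (1 - (P + Q).t) * ((1 - P.t) * (1 - Q.t)) =
    (((1 - P.t) * (1 - Q.t) - A * P.r * Q.r) / (1 + P.t * Q.t)) ^ 2 := by
  have hd := (denom_pos P Q).ne'
  have hw := prod_sq P Q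
  rw [add_t, addT, one_sub_div (pow_ne_zero 2 hd), div_mul_eq_mul_div, div_pow]
  congr 1
  linear_combination -hw

theorem one_add_add_t_mul_mul (P Q : SignedParam A hA) :
    (1 + (P + Q).t) * ((1 + P.t) * (1 + Q.t)) =
    (((1 + P.t) * (1 + Q.t) + A * P.r * Q.r) / (1 + P.t * Q.t)) ^ 2 := by
  have hd := (denom_pos P Q).ne'
  have hw := prod_sq P Q
  rw [add_t, addT, one_add_div (pow_ne_zero 2 hd), div_mul_eq_mul_div, div_pow]
  congr 1
  linear_combination -hw

/-- A point whose `A t`, `1 - t` and `1 + t` are squares is twice another point: the classical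
halving formula. -/
theorem exists_add_self_eq (P : SignedParam A hA) (ht : P.t ≠ 0) (he : IsSquare (A * P.t))
    (hf : IsSquare (1 - P.t)) (hg : IsSquare (1 + P.t)) : ∃ R : SignedParam A hA, P = R + R := by
  obtain ⟨e, he⟩ := isSquare_iff_exists_sq _ |>.mp he
  obtain ⟨f, hf⟩ := isSquare_iff_exists_sq _ |>.mp hf
  obtain ⟨g, hg⟩ := isSquare_iff_exists_sq _ |>.mp hg
  -- The nonnegative square roots are the choice that puts the half into `0 ≤ t ≤ 1`.
  obtain ⟨f, hf0, hf⟩ : ∃ f' : ℚ, 0 ≤ f' ∧ 1 - P.t = f' ^ 2 :=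
    ⟨|f|, abs_nonneg f, by rw [sq_abs, hf]⟩
  obtain ⟨g, hg0, hg⟩ : ∃ g' : ℚ, 0 ≤ g' ∧ 1 + P.t = g' ^ 2 :=
    ⟨|g|, abs_nonneg g, by rw [sq_abs, hg]⟩
  have he0 : e ≠ 0 := by
    rintro rfl
    have : A * P.t = 0 := by rw [he]; ring
    exact (mul_ne_zero hA.ne' ht) this
  have htf : P.t = 1 - f ^ 2 := by linarith
  have hgf : g ^ 2 = 2 - f ^ 2 := by linarith
  have hf1 : f ≤ 1 := by nlinarith [P.t_nonneg]
  have hf1' : 1 + f ≠ 0 := by positivity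
  have hg1 : 1 + g ≠ 0 := by positivity
  have hfg : (2 + g - f) * (1 + f) = (f + g) * (1 + g) := by linear_combination -hgf
  have hA2 : A * (1 - f ^ 2) = e ^ 2 := by rw [← htf, he]
  let R : SignedParam A hA :=
    { t := (1 - f) / (1 + g)
      r := (1 - f) * (f + g) / (e * (1 + g))
      t_nonneg := div_nonneg (by linarith) (by linarith)
      t_le_one := by rw [div_le_one (by positivity)]; linarith
      curve := by
        field_simp
        apply mul_right_cancel₀ hf1'
        linear_combination (1 - f) * e ^ 2 * (f + g) * hfg -
          (1 - f) * (f + g) ^ 2 * (1 + g) * hA2 }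
  have hR : (R + R).t = P.t := by
    have hc := R.curve
    have hd := denom_pos R R
    have h1 : (R + R).t = 4 * (R.t * (1 - R.t ^ 2)) / (1 + R.t ^ 2) ^ 2 := by
      rw [add_t, addT, show 1 + R.t * R.t = 1 + R.t ^ 2 by ring]
      congr 1
      linear_combination -2 * hc
    have h2 : R.t = (1 - f) / (1 + g) := rfl
    have h3 : 1 + R.t ^ 2 ≠ 0 := by nlinarith
    have h4 : 1 + R.t ^ 2 = 2 * (2 + g - f) / (1 + g) ^ 2 := by
      rw [h2]; field_simp; linear_combination hgf
    have h5 : 2 + g - f ≠ 0 := by linarith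
    have h6 : R.t * (1 - R.t ^ 2) = (1 - f) * (f + g) * (2 + g - f) / (1 + g) ^ 3 := by
      rw [h2]; field_simp; ring
    rw [h1, h4, h6, htf]
    field_simp
    linear_combination (-4 * (1 - f)) * hfg
  have hr : (R + R).r ^ 2 = P.r ^ 2 := by
    have h1 := (R + R).curve
    rw [hR, P.curve] at h1
    exact (mul_left_cancel₀ hA.ne' h1).symm
  rcases sq_eq_sq_iff_eq_or_eq_neg.mp hr with h | h
  · exact ⟨R, SignedParam.ext hR.symm h.symm⟩
  · refine ⟨-R, ?_⟩
    rw [← neg_add]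
    exact SignedParam.ext hR.symm (by rw [neg_r, h, neg_neg])

theorem exists_add_self_eq_add (P Q : SignedParam A hA) (hP0 : P.t ≠ 0) (hQ0 : Q.t ≠ 0)
    (hP1 : P.t ≠ 1) (hQ1 : Q.t ≠ 1) (h0 : IsSquare (P.t * Q.t))
    (h1 : IsSquare ((1 - P.t) * (1 - Q.t))) (h2 : IsSquare ((1 + P.t) * (1 + Q.t))) :
    ∃ R : SignedParam A hA, P + Q = R + R := by
  have hP := P.t_nonneg
  have hQ := Q.t_nonneg
  have key : ∀ {x y z : ℚ}, y ≠ 0 → IsSquare y → IsSquare z → x * y = z → IsSquare x := by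
    intro x y z hy hys hz h
    rw [eq_div_of_mul_eq hy h]
    exact hz.div hys
  by_cases ht : (P + Q).t = 0
  · exact ⟨0, by rw [eq_zero_of_t _ ht, add_zero]⟩
  apply exists_add_self_eq _ ht
  · refine key (mul_ne_zero hP0 hQ0) h0
      (z := (A * ((Q.t * P.r + P.t * Q.r) / (1 + P.t * Q.t))) ^ 2) (IsSquare.sq _) ?_
    linear_combination A * add_t_mul_mul P Q
  · exact key (mul_ne_zero (sub_ne_zero.mpr hP1.symm) (sub_ne_zero.mpr hQ1.symm)) h1
      (IsSquare.sq _) (one_sub_add_t_mul_mul P Q)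
  · exact key (by positivity) h2 (IsSquare.sq _) (one_add_add_t_mul_mul P Q)

/-! ### Finiteness of the square classes -/

/-- At a prime `p` at which `2` and `A` are units, at most one of `t`, `1 - t`, `1 + t` has nonzero
valuation unless `t` has a pole at `p`, when the three valuations agree; as they add up to an even number,
each of them is even. -/
theorem even_padicValRat (P : SignedParam A hA) (h0 : P.t ≠ 0) (h1 : P.t ≠ 1) {p : ℕ}
    [Fact p.Prime] (hp2 : padicValRat p 2 = 0) (hpA : padicValRat p A = 0) :
    Even (padicValRat p P.t) ∧ Even (padicValRat p (1 - P.t)) ∧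
      Even (padicValRat p (1 + P.t)) := by
  have hc := P.curve
  have ht := P.t_nonneg
  generalize P.t = t at *
  generalize P.r = r at *
  have hm : 1 - t ≠ 0 := sub_ne_zero.mpr h1.symm
  have hq : 1 + t ≠ 0 := by positivity
  have hr : r ≠ 0 := by
    rintro rfl
    have : t * ((1 - t) * (1 + t)) = 0 := by linear_combination hc
    exact mul_ne_zero h0 (mul_ne_zero hm hq) this
  have hsum : padicValRat p t + (padicValRat p (1 - t) + padicValRat p (1 + t)) =
      2 * padicValRat p r := by
    rw [← padicValRat.mul hm hq, ← padicValRat.mul h0 (mul_ne_zero hm hq),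
      show t * ((1 - t) * (1 + t)) = A * r ^ 2 by linear_combination hc,
      padicValRat.mul hA.ne' (pow_ne_zero 2 hr), padicValRat.pow, hpA]
    norm_num
  have tri : ∀ x y z : ℚ, z ≠ 0 → x + y = z →
      min (padicValRat p x) (padicValRat p y) ≤ padicValRat p z := by
    rintro x y z hz rfl
    exact padicValRat.min_le_padicValRat_add hz
  have e1 := tri t (1 - t) 1 one_ne_zero (by ring)
  have e2 := tri (1 + t) (-t) 1 one_ne_zero (by ring)
  have e3 := tri (1 - t) (1 + t) 2 two_ne_zero (by ring)
  have e4 := tri 1 (-t) (1 - t) hm (by ring)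
  have e5 := tri 1 t (1 + t) hq (by ring)
  have e6 := tri 1 (-(1 - t)) t h0 (by ring)
  have e7 := tri (1 + t) (-1) t h0 (by ring)
  simp only [padicValRat.neg, padicValRat.one, hp2] at e1 e2 e3 e4 e5 e6 e7
  simp only [Int.even_iff]
  generalize padicValRat p t = a at *
  generalize padicValRat p (1 - t) = b at *
  generalize padicValRat p (1 + t) = c at *
  omega

/-- The prime `2` and the primes dividing the numerator or the denominator of `A`. -/
def badPrimes (A : ℚ) : Finset ℕ := (2 * A.num.natAbs * A.den).primeFactors

/-- The parities of the valuations of `t`, `1 - t` and `1 + t` at the bad primes. For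
`t ∉ {0, 1}` they determine the square classes of the three numbers. -/
noncomputable def squareClass (P : SignedParam A hA) : badPrimes A → Prop × Prop × Prop := fun p =>
  (Even (padicValRat p P.t), Even (padicValRat p (1 - P.t)), Even (padicValRat p (1 + P.t)))

theorem padicValRat_eq_zero_of_notMem_badPrimes (hA : 0 < A) {p : ℕ} (hp : p.Prime)
    (h : p ∉ badPrimes A) : padicValRat p 2 = 0 ∧ padicValRat p A = 0 := by
  have hn : A.num.natAbs ≠ 0 := by have := Rat.num_pos.mpr hA; omega
  have hnd : ¬ p ∣ 2 * A.num.natAbs * A.den := fun hd =>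
    h (Nat.mem_primeFactors.mpr ⟨hp, hd, by simp [hA.ne']⟩)
  rw [hp.dvd_mul, hp.dvd_mul] at hnd
  push Not at hnd
  obtain ⟨⟨h2, hn'⟩, hd⟩ := hnd
  constructor
  · have : padicValRat p ((2 : ℕ) : ℚ) = 0 := by
      rw [padicValRat.of_nat, padicValNat.eq_zero_of_not_dvd h2]; rfl
    exact_mod_cast this
  · rw [padicValRat, padicValInt, padicValNat.eq_zero_of_not_dvd hn',
      padicValNat.eq_zero_of_not_dvd hd]
    rfl

theorem even_padicValRat_iff_of_squareClass_eq {P Q : SignedParam A hA} (hP0 : P.t ≠ 0)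
    (hQ0 : Q.t ≠ 0) (hP1 : P.t ≠ 1) (hQ1 : Q.t ≠ 1) (h : P.squareClass = Q.squareClass) {p : ℕ}
    (hp : p.Prime) : (Even (padicValRat p P.t) ↔ Even (padicValRat p Q.t)) ∧
      (Even (padicValRat p (1 - P.t)) ↔ Even (padicValRat p (1 - Q.t))) ∧
      (Even (padicValRat p (1 + P.t)) ↔ Even (padicValRat p (1 + Q.t))) := by
  have := Fact.mk hp
  by_cases hb : p ∈ badPrimes A
  · simpa [squareClass] using congrFun h ⟨p, hb⟩
  · obtain ⟨h2, hpA⟩ := padicValRat_eq_zero_of_notMem_badPrimes hA hp hb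
    obtain ⟨a, b, c⟩ := P.even_padicValRat hP0 hP1 h2 hpA
    obtain ⟨a', b', c'⟩ := Q.even_padicValRat hQ0 hQ1 h2 hpA
    simp [*]

/-- The weak Mordell–Weil theorem, in the form used by the descent. -/
theorem exists_add_self_eq_add_of_squareClass_eq {P Q : SignedParam A hA} (hP0 : P.t ≠ 0)
    (hQ0 : Q.t ≠ 0) (hP1 : P.t ≠ 1) (hQ1 : Q.t ≠ 1) (h : P.squareClass = Q.squareClass) :
    ∃ R : SignedParam A hA, P + Q = R + R := by
  have key := fun (p : ℕ) (hp : p.Prime) =>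
    even_padicValRat_iff_of_squareClass_eq hP0 hQ0 hP1 hQ1 h hp
  have hP := P.t_nonneg
  have hQ := Q.t_nonneg
  exact exists_add_self_eq_add P Q hP0 hQ0 hP1 hQ1
    (Rat.isSquare_mul_of_even_padicValRat_iff (hP.lt_of_ne' hP0) (hQ.lt_of_ne' hQ0)
      fun p hp => (key p hp).1)
    (Rat.isSquare_mul_of_even_padicValRat_iff (sub_pos.mpr (P.t_le_one.lt_of_ne hP1))
      (sub_pos.mpr (Q.t_le_one.lt_of_ne hQ1)) fun p hp => (key p hp).2.1)
    (Rat.isSquare_mul_of_even_padicValRat_iff (by positivity) (by positivity)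
      fun p hp => (key p hp).2.2)

/-! ### The denominator of the parameter as a height -/

/-- For a fixed `Q`, adding `Q` at most doubles the logarithm of the denominator, up to a constant:
if `t₁ = p / q` and `t₂ = a / b`, then `(p a + q b) ^ 2` is a denominator of the sum. -/
theorem den_add_le (P Q : SignedParam A hA) :
    (P + Q).t.den ≤ 4 * P.t.den ^ 2 * Q.t.den ^ 2 := by
  have hw := prod_sq P Q
  have hP0 := P.t_nonneg
  have hQ0 := Q.t_nonneg
  have hP1 := P.t_le_one
  have hQ1 := Q.t_le_one
  rw [add_t, addT]
  generalize A * P.r * Q.r = w at *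
  generalize P.t = t at *
  generalize Q.t = s at *
  have hp := Rat.mul_den_eq_num t
  have ha := Rat.mul_den_eq_num s
  have hq0 : (0 : ℚ) < t.den := by exact_mod_cast t.den_pos
  have hb0 : (0 : ℚ) < s.den := by exact_mod_cast s.den_pos
  have hp0 : 0 ≤ t.num := Rat.num_nonneg.mpr hP0
  have ha0 : 0 ≤ s.num := Rat.num_nonneg.mpr hQ0
  have hpq : t.num ≤ t.den := by
    have : (t.num : ℚ) ≤ t.den := by rw [← hp]; nlinarith
    exact_mod_cast this
  have hab : s.num ≤ s.den := by
    have : (s.num : ℚ) ≤ s.den := by rw [← ha]; nlinarith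
    exact_mod_cast this
  have hq1 : (0 : ℤ) < t.den := by exact_mod_cast t.den_pos
  have hb1 : (0 : ℤ) < s.den := by exact_mod_cast s.den_pos
  suffices h : ∃ k : ℤ,
      (s * (1 - t ^ 2) + t * (1 - s ^ 2) + 2 * w) / (1 + t * s) ^ 2 =
        (k : ℚ) / (((t.den * s.den + t.num * s.num) ^ 2 : ℤ) : ℚ) by
    obtain ⟨k, hk⟩ := h
    rw [hk, ← Rat.divInt_eq_div]
    have h1 := Int.le_of_dvd (by positivity)
      (Rat.den_dvd k ((t.den * s.den + t.num * s.num) ^ 2 : ℤ))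
    have h2 : t.num * s.num ≤ t.den * s.den := by gcongr
    have h3 : ((t.den * s.den + t.num * s.num) ^ 2 : ℤ) ≤ (2 * (t.den * s.den)) ^ 2 := by
      gcongr
      linarith
    zify
    calc _ ≤ _ := h1
      _ ≤ _ := h3
      _ = _ := by ring
  generalize t.den = q at *
  generalize s.den = b at *
  generalize t.num = p at *
  generalize s.num = a at *
  obtain rfl : t = p / q := by field_simp; exact hp
  obtain rfl : s = a / b := by field_simp; exact ha
  -- The square of `w q² b²` is an integer, so `w q² b²` itself is one.
  obtain ⟨m, hm⟩ : ∃ m : ℤ, w * q ^ 2 * b ^ 2 = m := by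
    have hz : (w * q ^ 2 * b ^ 2) ^ 2 =
        ((p * q * (q ^ 2 - p ^ 2) * (a * b * (b ^ 2 - a ^ 2)) : ℤ) : ℚ) := by
      rw [mul_pow, mul_pow, hw]
      push_cast
      field_simp
    have hs : IsSquare ((p * q * (q ^ 2 - p ^ 2) * (a * b * (b ^ 2 - a ^ 2)) : ℤ) : ℚ) :=
      ⟨w * q ^ 2 * b ^ 2, by rw [← hz, sq]⟩
    obtain ⟨m, hm⟩ := Rat.isSquare_intCast_iff.mp hs
    have h2 : (w * q ^ 2 * b ^ 2) ^ 2 = (m : ℚ) ^ 2 := by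
      rw [hz, hm]; push_cast; ring
    rcases sq_eq_sq_iff_eq_or_eq_neg.mp h2 with h | h
    · exact ⟨m, h⟩
    · exact ⟨-m, by rw [h]; push_cast; ring⟩
  refine ⟨a * b * (q ^ 2 - p ^ 2) + p * q * (b ^ 2 - a ^ 2) + 2 * m, ?_⟩
  have hpos : (0 : ℚ) < q * b + p * a := by
    have : (0 : ℤ) < q * b + p * a := by positivity
    exact_mod_cast this
  push_cast
  rw [← hm]
  field_simp

/-- For coprime `p`, `q`, any cancellation in `4 p q (q² - p²) / (p² + q²)²` is by a divisor
of `16`. -/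
theorem sq_add_sq_sq_dvd {p q N D : ℤ} (h : IsCoprime p q)
    (hND : N * (p ^ 2 + q ^ 2) ^ 2 = 4 * (p * q * (q ^ 2 - p ^ 2)) * D) :
    (p ^ 2 + q ^ 2) ^ 2 ∣ 16 * D := by
  obtain ⟨x, y, hxy⟩ := h.pow (m := 2) (n := 2)
  have hcp : IsCoprime ((p ^ 2 + q ^ 2) ^ 2) p := by
    refine IsCoprime.pow_left ?_
    rw [show p ^ 2 + q ^ 2 = q ^ 2 + p * p by ring]
    exact IsCoprime.add_mul_right_left h.symm.pow_left p
  have hcq : IsCoprime ((p ^ 2 + q ^ 2) ^ 2) q := by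
    refine IsCoprime.pow_left ?_
    rw [show p ^ 2 + q ^ 2 = p ^ 2 + q * q by ring]
    exact IsCoprime.add_mul_right_left h.pow_left q
  have h1 : (p ^ 2 + q ^ 2) ^ 2 ∣ p * (q * (4 * (q ^ 2 - p ^ 2) * D)) :=
    ⟨N, by linear_combination -hND⟩
  obtain ⟨c, hc⟩ := hcq.dvd_of_dvd_mul_left (hcp.dvd_of_dvd_mul_left h1)
  -- With `s = p² + q²` and `a = q² - p²`, some `u s + v a = 2`, so `v a (2 + u s) ≡ 4` modulo `s²`.
  refine ⟨c * (y - x) * (2 + (x + y) * (p ^ 2 + q ^ 2)) + 4 * D * (x + y) ^ 2, ?_⟩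
  have h2 : (x + y) * (p ^ 2 + q ^ 2) + (y - x) * (q ^ 2 - p ^ 2) = 2 := by
    linear_combination 2 * hxy
  linear_combination (y - x) * (2 + (x + y) * (p ^ 2 + q ^ 2)) * hc
    - 4 * D * (2 + (x + y) * (p ^ 2 + q ^ 2)) * h2

/-- Doubling multiplies the logarithm of the denominator by at least four, up to a constant. -/
theorem den_pow_four_le (R : SignedParam A hA) : R.t.den ^ 4 ≤ 16 * (R + R).t.den := by
  have hT : (R + R).t = 4 * (R.t * (1 - R.t ^ 2)) / (1 + R.t ^ 2) ^ 2 := by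
    rw [add_t, addT, show 1 + R.t * R.t = 1 + R.t ^ 2 by ring]
    congr 1
    linear_combination -2 * R.curve
  generalize (R + R).t = T at *
  generalize R.t = t at *
  have hp := Rat.mul_den_eq_num t
  have hN := Rat.mul_den_eq_num T
  have hq0 : (0 : ℚ) < t.den := by exact_mod_cast t.den_pos
  have hD0 : (0 : ℚ) < T.den := by exact_mod_cast T.den_pos
  have hD1 : (0 : ℤ) < T.den := by exact_mod_cast T.den_pos
  have hcop : IsCoprime t.num t.den := by
    rw [Int.isCoprime_iff_gcd_eq_one]
    exact t.reduced
  have hND : T.num * (t.num ^ 2 + (t.den : ℤ) ^ 2) ^ 2 =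
      4 * (t.num * t.den * (t.den ^ 2 - t.num ^ 2)) * T.den := by
    have ht : t = t.num / t.den := by field_simp; exact hp
    have : (T.num * (t.num ^ 2 + (t.den : ℚ) ^ 2) ^ 2) =
        4 * (t.num * t.den * (t.den ^ 2 - t.num ^ 2)) * T.den := by
      rw [← hN, hT, ← hp]
      have : 1 + t ^ 2 ≠ 0 := by positivity
      field_simp
      ring
    exact_mod_cast this
  have h1 := Int.le_of_dvd (by positivity) (sq_add_sq_sq_dvd hcop hND)
  zify
  nlinarith [sq_nonneg t.num, sq_nonneg (t.den : ℤ),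
    mul_nonneg (sq_nonneg t.num) (sq_nonneg (t.den : ℤ))]

theorem finite_setOf_den_le (B : ℕ) : {P : SignedParam A hA | P.t.den ≤ B}.Finite := by
  have hfin : (Set.Icc (0 : ℤ) B ×ˢ Set.Icc 0 B : Set (ℤ × ℕ)).Finite :=
    (Set.finite_Icc _ _).prod (Set.finite_Icc _ _)
  have hfib : ∀ t : ℚ, {P : SignedParam A hA | P.t = t}.Finite := by
    intro t
    by_cases hne : ∃ P : SignedParam A hA, P.t = t
    · obtain ⟨P, hP⟩ := hne
      refine (Set.toFinite {P, -P}).subset fun Q hQ => ?_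
      have ht : Q.t = P.t := by rw [hP]; exact hQ
      have h1 := Q.curve
      rw [ht, P.curve] at h1
      rcases sq_eq_sq_iff_eq_or_eq_neg.mp (mul_left_cancel₀ hA.ne' h1).symm with h | h
      · exact Or.inl (SignedParam.ext ht h)
      · exact Or.inr (SignedParam.ext ht h)
    · refine Set.finite_empty.subset fun Q hQ => hne ⟨Q, hQ⟩
  refine (hfin.biUnion fun x _ => hfib (x.1 / x.2)).subset fun P hP => ?_
  have hq0 : (0 : ℚ) < P.t.den := by exact_mod_cast P.t.den_pos
  have hpq : P.t.num ≤ P.t.den := by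
    have : (P.t.num : ℚ) ≤ P.t.den := by
      rw [← Rat.mul_den_eq_num]; nlinarith [P.t_le_one]
    exact_mod_cast this
  have hP' : P.t.den ≤ B := hP
  simp only [Set.mem_iUnion]
  refine ⟨(P.t.num, P.t.den), ⟨⟨Rat.num_nonneg.mpr P.t_nonneg, ?_⟩, Nat.zero_le _, hP'⟩,
    (Rat.num_div_den P.t).symm⟩
  change P.t.num ≤ B
  omega

/-! ### Descent -/

/-- One point from each square class, the points with `t ∈ {0, 1}` left aside: the heights of
these representatives have a bound. -/
theorem exists_den_bound : ∃ M : ℕ, ∀ P : SignedParam A hA, P.t ≠ 0 → P.t ≠ 1 →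
    ∃ Q : SignedParam A hA, Q.t ≠ 0 ∧ Q.t ≠ 1 ∧ Q.t.den ≤ M ∧ P.squareClass = Q.squareClass := by
  classical
  let C := {c : badPrimes A → Prop × Prop × Prop //
    ∃ Q : SignedParam A hA, Q.t ≠ 0 ∧ Q.t ≠ 1 ∧ Q.squareClass = c}
  choose rep hrep using fun c : C => c.2
  refine ⟨Finset.univ.sup fun c : C => (rep c).t.den, fun P h0 h1 => ?_⟩
  let c : C := ⟨P.squareClass, P, h0, h1, rfl⟩
  exact ⟨rep c, (hrep c).1, (hrep c).2.1,
    Finset.le_sup (f := fun c : C => (rep c).t.den) (Finset.mem_univ c), (hrep c).2.2.symm⟩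

theorem exists_closure_den_le_eq_top :
    ∃ B : ℕ, AddSubgroup.closure {P : SignedParam A hA | P.t.den ≤ B} = ⊤ := by
  obtain ⟨M, hM⟩ := exists_den_bound (hA := hA)
  refine ⟨8 * M + 1, ?_⟩
  rw [eq_top_iff]
  suffices h : ∀ (n : ℕ) (P : SignedParam A hA), P.t.den = n →
      P ∈ AddSubgroup.closure {P : SignedParam A hA | P.t.den ≤ 8 * M + 1} from
    fun P _ => h _ P rfl
  intro n
  induction n using Nat.strong_induction_on with
  | _ n ih =>
    rintro P rfl
    by_cases hB : P.t.den ≤ 8 * M + 1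
    · exact AddSubgroup.subset_closure hB
    -- The parameters `0` and `1` have denominator `1`.
    have h0 : P.t ≠ 0 := fun h => hB (by simp [h])
    have h1 : P.t ≠ 1 := fun h => hB (by simp [h])
    obtain ⟨Q, hQ0, hQ1, hQM, hPQ⟩ := hM P h0 h1
    obtain ⟨R, hR⟩ := exists_add_self_eq_add_of_squareClass_eq h0 hQ0 h1 hQ1 hPQ
    have hlt : R.t.den < P.t.den := by
      have e1 := den_pow_four_le R
      have e2 := den_add_le P Q
      rw [← hR] at e1
      have e3 : (8 * Q.t.den) ^ 2 < P.t.den ^ 2 := Nat.pow_lt_pow_left (by omega) two_ne_zero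
      refine lt_of_pow_lt_pow_left₀ 4 (Nat.zero_le _) ?_
      calc R.t.den ^ 4 ≤ 16 * (4 * P.t.den ^ 2 * Q.t.den ^ 2) := by omega
        _ = P.t.den ^ 2 * (8 * Q.t.den) ^ 2 := by ring
        _ < P.t.den ^ 2 * P.t.den ^ 2 := by
          have := P.t.den_pos
          gcongr
        _ = P.t.den ^ 4 := by ring
    have hRmem := ih _ hlt R rfl
    have hQmem : Q ∈ AddSubgroup.closure {P : SignedParam A hA | P.t.den ≤ 8 * M + 1} :=
      AddSubgroup.subset_closure (show Q.t.den ≤ 8 * M + 1 by omega)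
    rw [eq_sub_of_add_eq hR]
    exact sub_mem (add_mem hRmem hRmem) hQmem

instance : Module.Finite ℤ (SignedParam A hA) := by
  obtain ⟨B, hB⟩ := exists_closure_den_le_eq_top (hA := hA)
  rw [Module.Finite.iff_addGroup_fg]
  exact (AddGroup.fg_iff).mpr ⟨_, hB, finite_setOf_den_le B⟩

end SignedParam

theorem theorem3 (A : ℚ) (hA : 0 < A) :
    ∃ (r : ℕ) (Δ : Fin r → RatRightTriangle A), ∀ T : RatRightTriangle A,
      ∃ a : Fin r → ℤ, T.toParam hA = ∑ i, a i • (Δ i).toParam hA := by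
  classical
  -- The triangles span a subgroup of a Noetherian module; it is spanned by finitely many of them.
  obtain ⟨s, hs, hspan⟩ := (Submodule.fg_span_iff_fg_span_finset_subset (R := ℤ)
    (Set.range fun T : RatRightTriangle A => T.toParam hA)).mp (IsNoetherian.noetherian _)
  choose tri htri using fun x : s => hs x.2
  refine ⟨s.card, fun i => tri (s.equivFin.symm i), fun T => ?_⟩
  have hT : T.toParam hA ∈ Submodule.span ℤ
      (Set.range fun i => (tri (s.equivFin.symm i)).toParam hA) := by
    have : Set.range (fun i => (tri (s.equivFin.symm i)).toParam hA) = (s : Set _) := by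
      ext x
      constructor
      · rintro ⟨i, rfl⟩
        exact (htri (s.equivFin.symm i)) ▸ (s.equivFin.symm i).2
      · intro hx
        exact ⟨s.equivFin ⟨x, hx⟩, by simpa using htri ⟨x, hx⟩⟩
    rw [this, ← hspan]
    exact Submodule.subset_span ⟨T, rfl⟩
  obtain ⟨a, ha⟩ := (Submodule.mem_span_range_iff_exists_fun ℤ).mp hT
  exact ⟨a, ha.symm⟩
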